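/- Let $k$ be an algebraically closed field, let $0\neq q\in k$, and put $$A=k\langle x,y\rangle/(x^2,\;xy-qyx,\;y^2),\qquad B=k\langle x,y\rangle/(x^2,\;y^2,\;xyx,\;yxy),\qquad w=xy-qyx\in B,$$ so that $w$ is central in $B$ and $A\cong B/(w)$. Let $\nu$ be the automorphism of $B$ with $\nu(x)=-q^{-1}x$ and $\nu(y)=-qy$. For a left $B$-module $M$ let ${}_\nu M$ be the module with the same underlying group on which $b\in B$ acts as $\nu(b)$ acts on $M$. A factorization is a sequence $F\xrightarrow{f}G\xrightarrow{g}{}_\nu F$ of $B$-linear maps, where $F$ and $G$ are finitely generated free left $B$-modules, such that $g\circ f$ and $f\circ g$ are multiplication by $w$. A morphism $(F_1,G_1,f_1,g_1)\to(F_2,G_2,f_2,g_2)$ is a pair of $B$-linear maps $\psi\colon F_1\to F_2$, $\phi\colon G_1\to G_2$ with $\phi f_1=f_2\psi$ and $\psi g_1=g_2\phi$. Two morphisms $(\psi,\phi)$, $(\psi',\phi')$ are homotopic if there are $B$-linear maps $s\colon G_1\to F_2$ and $t\colon{}_\nu F_1\to G_2$ with $\psi-\psi'=sf_1+g_2t$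 and $\phi-\phi'=tg_1+f_2s$ (as maps of the underlying groups). Let $\mathbf{HFact}$ be the category of factorizations and homotopy classes of morphisms. Let $\underline{\mathrm{mod}}\,A$ be the stable category of finitely generated left $A$-modules (maps modulo those that factor through a finitely generated projective module), and let $$T\colon\mathbf{HFact}\to\underline{\mathrm{mod}}\,A,\qquad T(F,G,f,g)=\operatorname{Im}\bigl(F/wF\xrightarrow{\ \overline f\ }G/wG\bigr)$$ be the functor induced by reduction modulo $w$. For $n\ge 1$ and $\lambda\in k$ let $J_n(\lambda)$ be the $n\times n$ Jordan matrix with $\lambda$ on the diagonal and $1$ on the superdiagonal. For $\lambda\in k\cup\{\infty\}$ let $C_n(\lambda)$ be the left $A$-module of row vectors $k^{2n}$ on which $x$ and $y$ act by right multiplication with $\left(\begin{smallmatrix}0&X\\0&0\end{smallmatrix}\right)$ and $\left(\begin{smallmatrix}0&Y\\0&0\end{smallmatrix}\right)$, where $(X,Y)=(J_n(\lambda),I_n)$ if $\lambda\in k$ and $(X,Y)=(I_n,J_n(0))$ if $\lambda=\infty$. Theorem. Let $n\ge1$. 1. For $\lambda\in k\cup\{\infty\}$, the module $C_n(\lambda)$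 is isomorphic in $\underline{\mathrm{mod}}\,A$ to an object in the image of $T$ if and only if $\lambda\notin\{0,\infty\}$. 2. For every $0\ne\lambda\in k$, let $f\colon B^n\to B^n$ be right multiplication of row vectors by the matrix $xI+q^{-1}y\,J_n(\lambda)$. There is $g\colon B^n\to{}_\nu B^n$ such that $(B^n,B^n,f,g)$ is a factorization, and $\operatorname{Im}\overline f$ is isomorphic to $C_n(\lambda)$ as an $A$-module. 3. There is no factorization $(F,G,f,g)$ for which $\operatorname{Im}(F/wF\to G/wG)$ is isomorphic, as an $A$-module, to $C_n(0)$ or to $C_n(\infty)$. 4. The action of $x$ on $C_n(0)$ and the action of $y$ on $C_n(\infty)$ have rank $n-1$ over $k$. In contrast, for every factorization $(F,G,f,g)$ whose module $\operatorname{Im}(F/wF\to G/wG)$ has dimension $2n$ over $k$, both $x$ and $y$ act on this module with rank $n$. -/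

import Mathlib

open CategoryTheory

noncomputable section

universe u

namespace QCI

/-! ### The algebras `B` and `A` -/

section Algebras

variable (k : Type u) [Field k]

/-- Defining relations of `B = k⟨x,y⟩/(x², y², xyx, yxy)`; the free generators `x`, `y` are
`FreeAlgebra.ι k 0` and `FreeAlgebra.ι k 1`. -/
inductive BRel : FreeAlgebra k (Fin 2) → FreeAlgebra k (Fin 2) → Prop
  | xx : BRel (FreeAlgebra.ι k 0 * FreeAlgebra.ι k 0) 0
  | yy : BRel (FreeAlgebra.ι k 1 * FreeAlgebra.ι k 1) 0
  | xyx : BRel (FreeAlgebra.ι k 0 * FreeAlgebra.ι k 1 * FreeAlgebra.ι k 0) 0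
  | yxy : BRel (FreeAlgebra.ι k 1 * FreeAlgebra.ι k 0 * FreeAlgebra.ι k 1) 0

/-- Defining relations of `A = k⟨x,y⟩/(x², xy - qyx, y²)`. -/
inductive ARel (q : kˣ) : FreeAlgebra k (Fin 2) → FreeAlgebra k (Fin 2) → Prop
  | xx : ARel q (FreeAlgebra.ι k 0 * FreeAlgebra.ι k 0) 0
  | yy : ARel q (FreeAlgebra.ι k 1 * FreeAlgebra.ι k 1) 0
  | comm : ARel q (FreeAlgebra.ι k 0 * FreeAlgebra.ι k 1 -
      (q : k) • (FreeAlgebra.ι k 1 * FreeAlgebra.ι k 0)) 0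

/-- `B = k⟨x,y⟩/(x², y², xyx, yxy)`. -/
def B : Type u := RingQuot (BRel k)

instance : Ring (B k) := inferInstanceAs (Ring (RingQuot (BRel k)))
instance : Algebra k (B k) := inferInstanceAs (Algebra k (RingQuot (BRel k)))

/-- The quantum complete intersection `A = k⟨x,y⟩/(x², xy - qyx, y²)`. -/
def A (q : kˣ) : Type u := RingQuot (ARel k q)

instance (q : kˣ) : Ring (A k q) := inferInstanceAs (Ring (RingQuot (ARel k q)))
instance (q : kˣ) : Algebra k (A k q) := inferInstanceAs (Algebra k (RingQuot (ARel k q)))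

/-- The quotient map `k⟨x,y⟩ → B`. -/
def mkB : FreeAlgebra k (Fin 2) →ₐ[k] B k := RingQuot.mkAlgHom k (BRel k)

/-- The quotient map `k⟨x,y⟩ → A`. -/
def mkA (q : kˣ) : FreeAlgebra k (Fin 2) →ₐ[k] A k q := RingQuot.mkAlgHom k (ARel k q)

lemma mkB_surjective : Function.Surjective (mkB k) := RingQuot.mkAlgHom_surjective k _

lemma mkA_surjective (q : kˣ) : Function.Surjective (mkA k q) := RingQuot.mkAlgHom_surjective k _

/-- The generator `x` of `B`. -/
def B.x : B k := mkB k (FreeAlgebra.ι k 0)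

/-- The generator `y` of `B`. -/
def B.y : B k := mkB k (FreeAlgebra.ι k 1)

/-- The generator `x` of `A`. -/
def A.x (q : kˣ) : A k q := mkA k q (FreeAlgebra.ι k 0)

/-- The generator `y` of `A`. -/
def A.y (q : kˣ) : A k q := mkA k q (FreeAlgebra.ι k 1)

lemma B.xx : B.x k * B.x k = 0 := by
  have h := RingQuot.mkAlgHom_rel k (BRel.xx (k := k))
  rw [map_mul, map_zero] at h
  exact h

lemma B.yy : B.y k * B.y k = 0 := by
  have h := RingQuot.mkAlgHom_rel k (BRel.yy (k := k))
  rw [map_mul, map_zero] at h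
  exact h

lemma B.xyx : B.x k * B.y k * B.x k = 0 := by
  have h := RingQuot.mkAlgHom_rel k (BRel.xyx (k := k))
  rw [map_mul, map_mul, map_zero] at h
  exact h

lemma B.yxy : B.y k * B.x k * B.y k = 0 := by
  have h := RingQuot.mkAlgHom_rel k (BRel.yxy (k := k))
  rw [map_mul, map_mul, map_zero] at h
  exact h

lemma A.xx (q : kˣ) : A.x k q * A.x k q = 0 := by
  have h := RingQuot.mkAlgHom_rel k (ARel.xx (k := k) (q := q))
  rw [map_mul, map_zero] at h
  exact h

lemma A.yy (q : kˣ) : A.y k q * A.y k q = 0 := by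
  have h := RingQuot.mkAlgHom_rel k (ARel.yy (k := k) (q := q))
  rw [map_mul, map_zero] at h
  exact h

lemma A.comm (q : kˣ) : A.x k q * A.y k q - (q : k) • (A.y k q * A.x k q) = 0 := by
  have h := RingQuot.mkAlgHom_rel k (ARel.comm (k := k) (q := q))
  rw [map_sub, map_smul, map_mul, map_mul, map_zero] at h
  exact h

/-- Universal property of `B`. -/
def B.lift {R : Type*} [Ring R] [Algebra k R] (X Y : R) (hxx : X * X = 0) (hyy : Y * Y = 0)
    (hxyx : X * Y * X = 0) (hyxy : Y * X * Y = 0) : B k →ₐ[k] R :=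
  RingQuot.liftAlgHom k ⟨FreeAlgebra.lift k ![X, Y], by
    intro a b h
    cases h <;> simp [hxx, hyy, hxyx, hyxy]⟩

/-- Universal property of `A`. -/
def A.lift (q : kˣ) {R : Type*} [Ring R] [Algebra k R] (X Y : R) (hxx : X * X = 0)
    (hyy : Y * Y = 0) (hxy : X * Y - (q : k) • (Y * X) = 0) : A k q →ₐ[k] R :=
  RingQuot.liftAlgHom k ⟨FreeAlgebra.lift k ![X, Y], by
    intro a b h
    cases h <;> simp [hxx, hyy, hxy]⟩

section
variable {R : Type*} [Ring R] [Algebra k R]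

lemma B.lift_x (X Y : R) (h1 h2 h3 h4) : B.lift k X Y h1 h2 h3 h4 (B.x k) = X := by
  refine (RingQuot.liftAlgHom_mkAlgHom_apply k _ _ _).trans ?_
  simp

lemma B.lift_y (X Y : R) (h1 h2 h3 h4) : B.lift k X Y h1 h2 h3 h4 (B.y k) = Y := by
  refine (RingQuot.liftAlgHom_mkAlgHom_apply k _ _ _).trans ?_
  simp

lemma A.lift_x (q : kˣ) (X Y : R) (h1 h2 h3) : A.lift k q X Y h1 h2 h3 (A.x k q) = X := by
  refine (RingQuot.liftAlgHom_mkAlgHom_apply k _ _ _).trans ?_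
  simp

lemma A.lift_y (q : kˣ) (X Y : R) (h1 h2 h3) : A.lift k q X Y h1 h2 h3 (A.y k q) = Y := by
  refine (RingQuot.liftAlgHom_mkAlgHom_apply k _ _ _).trans ?_
  simp

lemma B.hom_ext {f g : B k →ₐ[k] R} (hx : f (B.x k) = g (B.x k)) (hy : f (B.y k) = g (B.y k)) :
    f = g := by
  apply RingQuot.ringQuot_ext' k
  apply FreeAlgebra.hom_ext
  funext i
  fin_cases i
  · exact hx
  · exact hy

end

/-- The element `w = xy - qyx` of `B`. -/
def w (q : kˣ) : B k := B.x k * B.y k - (q : k) • (B.y k * B.x k)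

lemma w_central (q : kˣ) (b : B k) : b * w k q = w k q * b := by
  obtain ⟨p, rfl⟩ := mkB_surjective k b
  have h1 := B.xx k
  have h2 := B.yy k
  have h3 := B.xyx k
  have h4 := B.yxy k
  induction p using FreeAlgebra.induction with
  | grade0 r =>
    rw [AlgHom.commutes]
    exact Algebra.commutes r _
  | grade1 i =>
    fin_cases i
    · change B.x k * w k q = w k q * B.x k
      simp [w, mul_sub, sub_mul, ← mul_assoc, h1, h3]
      simp [mul_assoc, h1]
    · change B.y k * w k q = w k q * B.y k
      simp [w, mul_sub, sub_mul, ← mul_assoc, h2, h4]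
      simp [mul_assoc, h2]
  | mul a b ha hb => rw [map_mul, mul_assoc, hb, ← mul_assoc, ha, mul_assoc]
  | add a b ha hb => rw [map_add, add_mul, ha, hb, mul_add]

/-- The `k`-algebra endomorphism of `B` with `x ↦ ax`, `y ↦ by`. -/
def scale (a b : k) : B k →ₐ[k] B k :=
  B.lift k (a • B.x k) (b • B.y k) (by simp [B.xx]) (by simp [B.yy])
    (by simp [B.xyx]) (by simp [B.yxy])

/-- The automorphism `ν` of `B` with `ν(x) = -q⁻¹x` and `ν(y) = -qy`. -/
def nuAlg (q : kˣ) : B k ≃ₐ[k] B k :=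
  AlgEquiv.ofAlgHom (scale k (-(q : k)⁻¹) (-(q : k))) (scale k (-(q : k)) (-(q : k)⁻¹))
    (by apply B.hom_ext <;> simp [scale, B.lift_x, B.lift_y, smul_smul])
    (by apply B.hom_ext <;> simp [scale, B.lift_x, B.lift_y, smul_smul])

lemma nuAlg_x (q : kˣ) : nuAlg k q (B.x k) = (-(q : k)⁻¹) • B.x k := B.lift_x k _ _ _ _ _ _

lemma nuAlg_y (q : kˣ) : nuAlg k q (B.y k) = (-(q : k)) • B.y k := B.lift_y k _ _ _ _ _ _

/-- `ν` as a ring homomorphism. A `B`-linear map `M → _νN` into the module twisted by `ν`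
(`b` acts on `_νN` as `ν(b)` acts on `N`) is the same thing as a `ν`-semilinear map
`M →ₛₗ[nu k q] N`. -/
def nu (q : kˣ) : B k →+* B k := ((nuAlg k q : B k ≃ₐ[k] B k) : B k →ₐ[k] B k)

/-- `ν⁻¹` as a ring homomorphism. A `B`-linear map `_νM → N` is the same thing as a
`ν⁻¹`-semilinear map `M →ₛₗ[nuInv k q] N`. -/
def nuInv (q : kˣ) : B k →+* B k := ((nuAlg k q).symm : B k →ₐ[k] B k)

end Algebras

/-! ### Reduction modulo `w` -/

section Reduction

variable (k : Type u) [Field k] (q : kˣ)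

/-- The `B`-submodule `wM = {wm | m ∈ M}`. -/
def wSub (M : Type u) [AddCommGroup M] [Module (B k) M] : Submodule (B k) M where
  carrier := {m | ∃ m', m = w k q • m'}
  add_mem' := by
    rintro _ _ ⟨a, rfl⟩ ⟨b, rfl⟩
    exact ⟨a + b, (smul_add _ _ _).symm⟩
  zero_mem' := ⟨0, (smul_zero _).symm⟩
  smul_mem' := by
    rintro c _ ⟨a, rfl⟩
    exact ⟨c • a, by rw [smul_smul, smul_smul, w_central]⟩

/-- The abelian group `M/wM`, carrying its natural structure of a left `A`-module. -/
def Red (M : Type u) [AddCommGroup M] [Module (B k) M] : Type u := M ⧸ wSub k q M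

variable (M : Type u) [AddCommGroup M] [Module (B k) M]

instance : AddCommGroup (Red k q M) := inferInstanceAs (AddCommGroup (M ⧸ wSub k q M))

instance redModuleB : Module (B k) (Red k q M) := inferInstanceAs (Module (B k) (M ⧸ wSub k q M))

/-- The projection `M → M/wM`. -/
def redMk : M →ₗ[B k] Red k q M := (wSub k q M).mkQ

lemma redMk_surjective : Function.Surjective (redMk k q M) := (wSub k q M).mkQ_surjective

lemma redMk_eq_zero_iff (m : M) : redMk k q M m = 0 ↔ ∃ m', m = w k q • m' :=
  Submodule.Quotient.mk_eq_zero (wSub k q M)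

lemma w_smul_red (m : Red k q M) : w k q • m = 0 := by
  obtain ⟨m, rfl⟩ := redMk_surjective k q M m
  rw [← map_smul, redMk_eq_zero_iff]
  exact ⟨m, rfl⟩

/-- The action of `A` on `M/wM` as a ring homomorphism. -/
def redAction : A k q →+* AddMonoid.End (Red k q M) :=
  RingQuot.lift ⟨(Module.toAddMonoidEnd (B k) (Red k q M)).comp (mkB k).toRingHom, by
    intro a b h
    cases h with
    | xx =>
      have : mkB k (FreeAlgebra.ι k 0 * FreeAlgebra.ι k 0) = 0 := by
        rw [map_mul]; exact B.xx k
      simp [this]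
    | yy =>
      have : mkB k (FreeAlgebra.ι k 1 * FreeAlgebra.ι k 1) = 0 := by
        rw [map_mul]; exact B.yy k
      simp [this]
    | comm =>
      have : mkB k (FreeAlgebra.ι k 0 * FreeAlgebra.ι k 1 -
          (q : k) • (FreeAlgebra.ι k 1 * FreeAlgebra.ι k 0)) = w k q := by
        rw [map_sub, map_smul, map_mul, map_mul]; rfl
      ext m
      change mkB k _ • m = mkB k 0 • m
      rw [this, w_smul_red, map_zero, zero_smul]⟩

instance redModuleA : Module (A k q) (Red k q M) := Module.compHom _ (redAction k q M)

lemma mkA_smul_red (p : FreeAlgebra k (Fin 2)) (m : Red k q M) :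
    mkA k q p • m = mkB k p • m := by
  change redAction k q M (mkA k q p) m = _
  have h : mkA k q p = RingQuot.mkRingHom (ARel k q) p :=
    DFunLike.congr_fun (RingQuot.mkAlgHom_coe k (ARel k q)) p
  rw [h]
  exact DFunLike.congr_fun (RingQuot.lift_mkRingHom_apply _ _ p) m

instance [Module.Finite (B k) M] : Module.Finite (A k q) (Red k q M) := by
  have hB : Module.Finite (B k) (Red k q M) :=
    Module.Finite.of_surjective (redMk k q M) (redMk_surjective k q M)
  obtain ⟨S, hS⟩ := hB
  refine ⟨S, ?_⟩
  rw [eq_top_iff]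
  intro m _
  have hm : m ∈ Submodule.span (B k) (S : Set (Red k q M)) := by rw [hS]; trivial
  induction hm using Submodule.span_induction with
  | mem x hx => exact Submodule.subset_span hx
  | zero => exact Submodule.zero_mem _
  | add x y _ _ hx hy => exact Submodule.add_mem _ (hx trivial) (hy trivial)
  | smul b x _ hx =>
    obtain ⟨p, rfl⟩ := mkB_surjective k b
    rw [← mkA_smul_red]
    exact Submodule.smul_mem _ _ (hx trivial)

/-- The projection `B → A`. -/
def proj : B k →ₐ[k] A k q :=
  B.lift k (A.x k q) (A.y k q) (A.xx k q) (A.yy k q)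
    (by
      rw [sub_eq_zero.mp (A.comm k q), smul_mul_assoc, mul_assoc, A.xx, mul_zero, smul_zero])
    (by
      rw [mul_assoc, sub_eq_zero.mp (A.comm k q), mul_smul_comm, ← mul_assoc, A.yy, zero_mul,
        smul_zero])

lemma proj_mkB (p : FreeAlgebra k (Fin 2)) : proj k q (mkB k p) = mkA k q p := by
  have : (proj k q).comp (mkB k) = mkA k q := by
    apply FreeAlgebra.hom_ext
    funext i
    fin_cases i
    · exact B.lift_x k _ _ _ _ _ _
    · exact B.lift_y k _ _ _ _ _ _
  exact DFunLike.congr_fun this p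

lemma proj_w : proj k q (w k q) = 0 := by
  rw [w, map_sub, map_smul, map_mul, map_mul]
  have hx : proj k q (B.x k) = A.x k q := B.lift_x k _ _ _ _ _ _
  have hy : proj k q (B.y k) = A.y k q := B.lift_y k _ _ _ _ _ _
  rw [hx, hy, A.comm]

variable {M}
variable {N : Type u} [AddCommGroup N] [Module (B k) N]

/-- The `A`-linear map `M/wM → N/wN` induced by a `B`-linear map `M → N`. -/
def redMap (f : M →ₗ[B k] N) : Red k q M →ₗ[A k q] Red k q N where
  toFun := (wSub k q M).mapQ (wSub k q N) f (by
    rintro _ ⟨m, rfl⟩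
    exact ⟨f m, map_smul f _ _⟩)
  map_add' := map_add _
  map_smul' a m := by
    obtain ⟨p, rfl⟩ := mkA_surjective k q a
    rw [mkA_smul_red]
    exact (map_smul _ _ _).trans (mkA_smul_red k q N p _).symm

lemma redMap_mk (f : M →ₗ[B k] N) (m : M) :
    redMap k q f (redMk k q M m) = redMk k q N (f m) := rfl

/-- Reduction modulo `w` of a free (or projective) `B`-module is a projective `A`-module. -/
lemma red_projective (M : Type u) [AddCommGroup M] [Module (B k) M] [Module.Projective (B k) M] :
    Module.Projective (A k q) (Red k q M) := by
  refine Module.Projective.of_lifting_property'' fun f hf => ?_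
  let _ : Module (B k) (Red k q M →₀ A k q) := Module.compHom _ (proj k q).toRingHom
  have hsm : ∀ (b : B k) (z : Red k q M →₀ A k q), b • z = proj k q b • z := fun _ _ => rfl
  have hred : ∀ (b : B k) (z : Red k q M), b • z = proj k q b • z := by
    intro b z
    obtain ⟨p, rfl⟩ := mkB_surjective k b
    rw [proj_mkB, mkA_smul_red]
  let fB : (Red k q M →₀ A k q) →ₗ[B k] Red k q M :=
    { toFun := f
      map_add' := map_add f
      map_smul' := fun b z => by
        rw [hsm, map_smul, RingHom.id_apply, hred] }
  obtain ⟨h, hh⟩ := Module.projective_lifting_property fB (redMk k q M) hf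
  have hw : wSub k q M ≤ LinearMap.ker h := by
    rintro _ ⟨m, rfl⟩
    rw [LinearMap.mem_ker, map_smul, hsm, proj_w, zero_smul]
  refine ⟨{ toFun := (wSub k q M).liftQ h hw
            map_add' := map_add _
            map_smul' := ?_ }, ?_⟩
  · intro a z
    obtain ⟨p, rfl⟩ := mkA_surjective k q a
    rw [mkA_smul_red, RingHom.id_apply, ← proj_mkB, ← hsm]
    exact map_smul ((wSub k q M).liftQ h hw) _ _
  · ext z
    obtain ⟨m, rfl⟩ := redMk_surjective k q M z
    exact DFunLike.congr_fun hh m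

end Reduction

/-! ### The homotopy category of twisted matrix factorizations -/

section Factorizations

variable (k : Type u) [Field k] (q : kˣ)

/-- A factorization `F --f--> G --g--> _νF` of `η_w` (multiplication by `w`), where `F` and `G` are
finitely generated free left `B`-modules: `g ∘ f = η_F` and `(S_ν f) ∘ g = η_G`. -/
structure Factorization where
  F : Type u
  G : Type u
  [addCommGroupF : AddCommGroup F]
  [addCommGroupG : AddCommGroup G]
  [moduleF : Module (B k) F]
  [moduleG : Module (B k) G]
  [freeF : Module.Free (B k) F]
  [freeG : Module.Free (B k) G]
  [finiteF : Module.Finite (B k) F]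
  [finiteG : Module.Finite (B k) G]
  f : F →ₗ[B k] G
  g : G →ₛₗ[nu k q] F
  g_f : ∀ m, g (f m) = w k q • m
  f_g : ∀ n, f (g n) = w k q • n

attribute [instance] Factorization.addCommGroupF Factorization.addCommGroupG
  Factorization.moduleF Factorization.moduleG Factorization.freeF Factorization.freeG
  Factorization.finiteF Factorization.finiteG

namespace Factorization

variable {k q}

/-- Morphisms of factorizations: pairs `(ψ, φ)` commuting with `f` and `g`. -/
@[ext]
structure Hom (X Y : Factorization k q) where
  psi : X.F →ₗ[B k] Y.F
  phi : X.G →ₗ[B k] Y.G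
  comm_f : ∀ m, phi (X.f m) = Y.f (psi m)
  comm_g : ∀ n, psi (X.g n) = Y.g (phi n)

instance : Category (Factorization k q) where
  Hom := Hom
  id X := ⟨LinearMap.id, LinearMap.id, fun _ => rfl, fun _ => rfl⟩
  comp a b := ⟨b.psi ∘ₗ a.psi, b.phi ∘ₗ a.phi,
    fun m => by simp [a.comm_f, b.comm_f], fun n => by simp [a.comm_g, b.comm_g]⟩

lemma id_psi (X : Factorization k q) : Hom.psi (𝟙 X) = LinearMap.id := rfl
lemma id_phi (X : Factorization k q) : Hom.phi (𝟙 X) = LinearMap.id := rfl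
lemma comp_psi {X Y Z : Factorization k q} (a : X ⟶ Y) (b : Y ⟶ Z) :
    Hom.psi (a ≫ b) = Hom.psi b ∘ₗ Hom.psi a := rfl
lemma comp_phi {X Y Z : Factorization k q} (a : X ⟶ Y) (b : Y ⟶ Z) :
    Hom.phi (a ≫ b) = Hom.phi b ∘ₗ Hom.phi a := rfl

variable (k q) in
/-- Homotopy of morphisms `(ψ, φ)`, `(ψ', φ')`: there are `B`-linear maps `s : G₁ → F₂` and
`t : _νF₁ → G₂` with `ψ - ψ' = s ∘ f₁ + S⁻¹(g₂ ∘ t)` and `φ - φ' = t ∘ g₁ + f₂ ∘ s`. -/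
def homotopic : HomRel (Factorization k q) := fun X Y a b =>
  ∃ (s : X.G →ₗ[B k] Y.F) (t : X.F →ₛₗ[nuInv k q] Y.G),
    (∀ m, a.psi m - b.psi m = s (X.f m) + Y.g (t m)) ∧
    (∀ n, a.phi n - b.phi n = t (X.g n) + Y.f (s n))

instance : Congruence (homotopic k q) where
  comp_left := by
    rintro X Y Z a b b' ⟨s, t, h1, h2⟩
    refine ⟨s ∘ₗ a.phi, t.comp a.psi, fun m => ?_, fun n => ?_⟩
    · simp [comp_psi, h1, a.comm_f]
    · simp [comp_phi, h2, a.comm_g]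
  comp_right := by
    rintro X Y Z a a' b ⟨s, t, h1, h2⟩
    refine ⟨b.psi ∘ₗ s, (b.phi.comp t : X.F →ₛₗ[nuInv k q] Z.G), fun m => ?_, fun n => ?_⟩
    · simp [comp_psi, ← map_sub, h1, b.comm_g]
    · simp [comp_phi, ← map_sub, h2, b.comm_f]
  equivalence := by
    intro X Y
    refine ⟨fun a => ⟨0, 0, by simp, by simp⟩, ?_, ?_⟩
    · rintro a b ⟨s, t, h1, h2⟩
      refine ⟨-s, -t, fun m => ?_, fun n => ?_⟩
      · rw [← neg_sub, h1]; simp; abel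
      · rw [← neg_sub, h2]; simp; abel
    · rintro a b c ⟨s, t, h1, h2⟩ ⟨s', t', h1', h2'⟩
      refine ⟨s + s', t + t', fun m => ?_, fun n => ?_⟩
      · rw [← sub_add_sub_cancel _ (b.psi m), h1, h1']; simp; abel
      · rw [← sub_add_sub_cancel _ (b.phi n), h2, h2']; simp; abel

end Factorization

/-- The homotopy category of factorizations. -/
abbrev HFact := CategoryTheory.Quotient (Factorization.homotopic k q)

end Factorizations

/-! ### The stable module category -/

section Stable

variable (k : Type u) [Field k] (q : kˣ)

/-- Two maps of finitely generated left `A`-modules are stably equal if their difference factors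
through a finitely generated projective module. -/
def stablyEqual : HomRel (FGModuleCat.{u} (A k q)) := fun M N f g =>
  ∃ (P : FGModuleCat.{u} (A k q)) (_ : Module.Projective (A k q) P) (a : M ⟶ P) (b : P ⟶ N),
    f - g = a ≫ b

instance : Congruence (stablyEqual k q) where
  comp_left := by
    rintro X Y Z f g g' ⟨P, hP, a, b, h⟩
    exact ⟨P, hP, f ≫ a, b, by rw [← Preadditive.comp_sub, h, Category.assoc]⟩
  comp_right := by
    rintro X Y Z f f' g ⟨P, hP, a, b, h⟩
    exact ⟨P, hP, a, b ≫ g, by rw [← Preadditive.sub_comp, h, Category.assoc]⟩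
  equivalence := by
    intro X Y
    refine ⟨fun f => ⟨FGModuleCat.of _ PUnit.{u + 1}, ?_, 0, 0, by simp⟩, ?_, ?_⟩
    · change Module.Projective (A k q) PUnit.{u + 1}
      infer_instance
    · rintro f g ⟨P, hP, a, b, h⟩
      exact ⟨P, hP, -a, b, by rw [Preadditive.neg_comp, ← h, neg_sub]⟩
    · rintro f g h ⟨P, hP, a, b, e⟩ ⟨P', hP', a', b', e'⟩
      refine ⟨FGModuleCat.of _ (P × P'), ?_,
        FGModuleCat.ofHom (a.hom.hom.prod a'.hom.hom),
        FGModuleCat.ofHom (b.hom.hom.coprod b'.hom.hom), ?_⟩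
      · change Module.Projective (A k q) (P × P')
        infer_instance
      · rw [← sub_add_sub_cancel f g h, e, e']
        ext x
        rfl

/-- The stable category of finitely generated left `A`-modules. -/
abbrev StableMod := CategoryTheory.Quotient (stablyEqual k q)

/-- The canonical functor from finitely generated `A`-modules to the stable category. -/
abbrev toStable : FGModuleCat.{u} (A k q) ⥤ StableMod k q :=
  CategoryTheory.Quotient.functor (stablyEqual k q)

variable {k q}

/-- Dimension of a finitely generated `A`-module over `k`. -/
def dim (M : FGModuleCat.{u} (A k q)) : ℕ :=
  Module.finrank k (RestrictScalars k (A k q) M)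

/-- Rank over `k` of the linear map given by the action of `a ∈ A` on a finitely generated
`A`-module. -/
def actionRank (M : FGModuleCat.{u} (A k q)) (a : A k q) : ℕ :=
  Module.finrank k (LinearMap.range (RestrictScalars.lsmul k (A k q) M a))

end Stable

/-! ### The functor `T` -/

section FunctorT

variable {k : Type u} [Field k] {q : kˣ}

/-- The image of `F/wF → G/wG`, a finitely generated left `A`-module. -/
def Factorization.im (X : Factorization k q) : FGModuleCat.{u} (A k q) :=
  FGModuleCat.of (A k q) (LinearMap.range (redMap k q X.f))

/-- The map induced on the images of `F/wF → G/wG` by a morphism of factorizations. -/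
def Factorization.imMap {X Y : Factorization k q} (a : X ⟶ Y) :
    LinearMap.range (redMap k q X.f) →ₗ[A k q] LinearMap.range (redMap k q Y.f) :=
  (redMap k q (Hom.phi a)).restrict (by
    rintro _ ⟨z, rfl⟩
    obtain ⟨m, rfl⟩ := redMk_surjective k q X.F z
    refine ⟨redMk k q Y.F (a.psi m), ?_⟩
    rw [redMap_mk, redMap_mk, redMap_mk, a.comm_f])

variable (k q)

/-- The functor from factorizations to `A`-modules, `(F, G, f, g) ↦ Im (F/wF → G/wG)`. -/
def imFunctor : Factorization k q ⥤ FGModuleCat.{u} (A k q) where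
  obj X := X.im
  map a := FGModuleCat.ofHom (Factorization.imMap a)
  map_id X := by
    ext ⟨z, hz⟩
    obtain ⟨m, rfl⟩ := redMk_surjective k q X.G z
    rfl
  map_comp a b := by
    ext ⟨z, hz⟩
    obtain ⟨m, rfl⟩ := redMk_surjective k q _ z
    rfl

/-- The functor `T` from the homotopy category of factorizations to the stable module category,
induced by `(F, G, f, g) ↦ Im (F/wF → G/wG)`. -/
def T : HFact k q ⥤ StableMod k q :=
  CategoryTheory.Quotient.lift _ (imFunctor k q ⋙ toStable k q) (by
    rintro X Y a b ⟨s, t, _, h2⟩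
    apply CategoryTheory.Quotient.sound
    refine ⟨FGModuleCat.of _ (Red k q X.G), red_projective k q X.G,
      FGModuleCat.ofHom (LinearMap.range (redMap k q X.f)).subtype,
      FGModuleCat.ofHom ((redMap k q Y.f).rangeRestrict ∘ₗ redMap k q s), ?_⟩
    ext ⟨z, hz⟩
    obtain ⟨z, rfl⟩ := hz
    obtain ⟨m, rfl⟩ := redMk_surjective k q X.F z
    apply Subtype.ext
    change redMk k q Y.G (a.phi (X.f m)) - redMk k q Y.G (b.phi (X.f m)) =
      redMk k q Y.G (Y.f (s (X.f m)))
    rw [← map_sub, h2, X.g_f, map_add, add_eq_right, redMk_eq_zero_iff]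
    have hw : nuInv k q (w k q) = w k q := by
      change (nuAlg k q).symm (w k q) = w k q
      rw [AlgEquiv.symm_apply_eq, w, map_sub, map_smul, map_mul, map_mul, nuAlg_x, nuAlg_y]
      simp [smul_smul]
    exact ⟨t m, by rw [LinearMap.map_smulₛₗ, hw]⟩)

end FunctorT

/-! ### The modules `C_n(λ)` -/

section Kronecker

variable (k : Type u) [Field k] (q : kˣ)

/-- The `n × n` Jordan matrix with eigenvalue `c` on the diagonal and ones on the
superdiagonal. -/
def jordan (n : ℕ) (c : k) : Matrix (Fin n) (Fin n) k :=
  Matrix.of fun i j => if i = j then c else if (i : ℕ) + 1 = j then 1 else 0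

/-- The upper right block of the matrix by which `x` acts on `C_n(l)`. -/
def blockX (n : ℕ) (l : OnePoint k) : Matrix (Fin n) (Fin n) k :=
  l.elim 1 fun c => jordan k n c

/-- The upper right block of the matrix by which `y` acts on `C_n(l)`. -/
def blockY (n : ℕ) (l : OnePoint k) : Matrix (Fin n) (Fin n) k :=
  l.elim (jordan k n 0) fun _ => 1

/-- The underlying vector space of `C_n(l)`. -/
@[nolint unusedArguments]
def CSpace (_ : kˣ) (n : ℕ) (_ : OnePoint k) : Type u := Fin n ⊕ Fin n → k

instance (n : ℕ) (l : OnePoint k) : AddCommGroup (CSpace k q n l) :=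
  inferInstanceAs (AddCommGroup (Fin n ⊕ Fin n → k))

instance (n : ℕ) (l : OnePoint k) : Module k (CSpace k q n l) :=
  inferInstanceAs (Module k (Fin n ⊕ Fin n → k))

instance (n : ℕ) (l : OnePoint k) : Module.Finite k (CSpace k q n l) :=
  inferInstanceAs (Module.Finite k (Fin n ⊕ Fin n → k))

variable {k} in
/-- The endomorphism of the space `k^{2n}` of row vectors given by right multiplication with the
block matrix `(0 J; 0 0)`. -/
def blockEnd {n : ℕ} (l : OnePoint k) (J : Matrix (Fin n) (Fin n) k) :
    Module.End k (CSpace k q n l) :=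
  (Matrix.fromBlocks 0 J 0 0 : Matrix (Fin n ⊕ Fin n) (Fin n ⊕ Fin n) k).vecMulLinear

variable {k} in
lemma blockEnd_mul {n : ℕ} (l : OnePoint k) (J J' : Matrix (Fin n) (Fin n) k) :
    blockEnd q l J * blockEnd q l J' = 0 := by
  have h : ∀ v : Fin n ⊕ Fin n → k, Matrix.vecMul (Matrix.vecMul v (Matrix.fromBlocks 0 J' 0 0))
      (Matrix.fromBlocks 0 J 0 0 : Matrix (Fin n ⊕ Fin n) (Fin n ⊕ Fin n) k) = 0 := by
    intro v
    rw [Matrix.vecMul_vecMul, Matrix.fromBlocks_multiply]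
    simp
  exact LinearMap.ext h

/-- The representation of `A` on `C_n(l)`. -/
def CAction (n : ℕ) (l : OnePoint k) : A k q →ₐ[k] Module.End k (CSpace k q n l) :=
  A.lift k q (blockEnd q l (blockX k n l)) (blockEnd q l (blockY k n l))
    (blockEnd_mul _ _ _ _) (blockEnd_mul _ _ _ _) (by simp [blockEnd_mul])

instance (n : ℕ) (l : OnePoint k) : Module (A k q) (CSpace k q n l) :=
  Module.compHom _ (CAction k q n l).toRingHom

lemma CSpace.smul_def (n : ℕ) (l : OnePoint k) (a : A k q) (v : CSpace k q n l) :
    a • v = CAction k q n l a v := rfl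

lemma CSpace.x_smul (n : ℕ) (l : OnePoint k) (v : CSpace k q n l) :
    A.x k q • v = Matrix.vecMul v (Matrix.fromBlocks 0 (blockX k n l) 0 0) := by
  rw [CSpace.smul_def, CAction, A.lift_x]
  rfl

lemma CSpace.y_smul (n : ℕ) (l : OnePoint k) (v : CSpace k q n l) :
    A.y k q • v = Matrix.vecMul v (Matrix.fromBlocks 0 (blockY k n l) 0 0) := by
  rw [CSpace.smul_def, CAction, A.lift_y]
  rfl

instance (n : ℕ) (l : OnePoint k) : IsScalarTower k (A k q) (CSpace k q n l) where
  smul_assoc c a v := by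
    rw [CSpace.smul_def, map_smul]
    rfl

instance (n : ℕ) (l : OnePoint k) : Module.Finite (A k q) (CSpace k q n l) :=
  Module.Finite.of_restrictScalars_finite k _ _

/-- The left `A`-module `C_n(l)`, for `l ∈ k ∪ {∞}`. -/
def C (n : ℕ) (l : OnePoint k) : FGModuleCat.{u} (A k q) :=
  FGModuleCat.of (A k q) (CSpace k q n l)

/-- The matrix `xI + q⁻¹ y J_n(c)` over `B`. -/
def matrixF (n : ℕ) (c : k) : Matrix (Fin n) (Fin n) (B k) :=
  Matrix.of fun i j => (if i = j then B.x k else 0) + ((q : k)⁻¹ * jordan k n c i j) • B.y k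

/-- Right multiplication of row vectors by `xI + q⁻¹ y J_n(c)`, a map `B^n → B^n` of left
`B`-modules. -/
def mapF (n : ℕ) (c : k) : (Fin n → B k) →ₗ[B k] (Fin n → B k) :=
  (matrixF k q n c).vecMulLinear

end Kronecker

end QCI

end

/-!
For an element `a` with `a² = 0` call `ker a / im a` the homology at `a` of a module on which `a`
acts; `ExactAt` says that it vanishes. The homology at `x` and at `y` separates the modules
`C_n(0)` and `C_n(∞)` from the modules coming from factorizations.

* It vanishes on `Im (F/wF → G/wG)` for every factorization (`exactAt_im_x`, `exactAt_im_y`).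
  This does not need minimal factorizations, or the exactness of the reduced complex: it is a
  chase (`exact_of_factorization`) using only that `f` and `g` compose to `w` and that in a free
  `B`-module the submodules `xG`, `yG`, `wG` meet pairwise trivially, the kernel of `x` is
  `xG + wG`, that of `y` is `yG + wG`, and that of `w` is `xG + yG` (`Divisibility`). These facts
  are read off from the basis `1, x, y, xy, yx` of `B`.
* It vanishes on projective `A`-modules, so its vanishing is invariant under isomorphism in the
  stable category (`ExactAt.of_stable_iso`).
* If it vanishes on a module of dimension `2n`, the element acts with rank `n`
  (`actionRank_of_exactAt`), by the rank-nullity theorem. As `x` on `C_n(0)` and `y` on `C_n(∞)`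
  act through `J_n(0)`, of rank `n - 1`, neither module is stably isomorphic to one coming from a
  factorization.

For `c ≠ 0`, the matrix `M = xI + q⁻¹ y J` with `J = J_n(c)` has the partner
`N = q (x J⁻¹ - y)`: both `ν(M) N` and `N M` are `w` times the identity, and since
`ν(b) w = w b` for all `b` (`nu_mul_w`) the map `g(v) = ν(v) N` completes `f` to a factorization.
Its module is `C_n(c)` through `(v₁, v₂) ↦ f(v₁ + y v₂)` (`equivC`); this is `A`-linear because
`xy = q yx` modulo `w`.
-/

noncomputable section

namespace QCI

/-! ### The basis `1, x, y, xy, yx` of `B` -/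

section Basis

variable {k : Type u} [Field k]

/-- The element `α + βx + γy + δxy + εyx` of `B`. -/
def B.comb (α β γ δ ε : k) : B k :=
  α • 1 + β • B.x k + γ • B.y k + δ • (B.x k * B.y k) + ε • (B.y k * B.x k)

lemma B.comb_mul (a b c d e a' b' c' d' e' : k) :
    B.comb a b c d e * B.comb a' b' c' d' e' =
      B.comb (a * a') (a * b' + b * a') (a * c' + c * a') (a * d' + b * c' + d * a')
        (a * e' + c * b' + e * a') := by
  have h1 := B.xx k
  have h2 := B.yy k
  have h3 := B.xyx k
  have h4 := B.yxy k
  have h5 : B.x k * (B.x k * B.y k) = 0 := by rw [← mul_assoc, h1, zero_mul]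
  have h6 : B.y k * (B.y k * B.x k) = 0 := by rw [← mul_assoc, h2, zero_mul]
  have h7 : B.x k * B.y k * B.y k = 0 := by rw [mul_assoc, h2, mul_zero]
  have h8 : B.y k * B.x k * B.x k = 0 := by rw [mul_assoc, h1, mul_zero]
  have h9 : B.x k * (B.y k * B.x k) = 0 := by rw [← mul_assoc, h3]
  have h10 : B.y k * (B.x k * B.y k) = 0 := by rw [← mul_assoc, h4]
  have h11 : B.x k * B.y k * (B.x k * B.y k) = 0 := by rw [← mul_assoc, h3, zero_mul]
  have h12 : B.x k * B.y k * (B.y k * B.x k) = 0 := by rw [← mul_assoc, h7, zero_mul]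
  have h13 : B.y k * B.x k * (B.x k * B.y k) = 0 := by rw [← mul_assoc, h8, zero_mul]
  have h14 : B.y k * B.x k * (B.y k * B.x k) = 0 := by rw [← mul_assoc, h4, zero_mul]
  simp only [B.comb, add_mul, mul_add, smul_mul_smul_comm, one_mul, mul_one, h1, h2, h3, h4, h5, h6,
    h7, h8, h9, h10, h11, h12, h13, h14, smul_zero]
  module

lemma B.comb_add (a b c d e a' b' c' d' e' : k) :
    B.comb a b c d e + B.comb a' b' c' d' e' =
      B.comb (a + a') (b + b') (c + c') (d + d') (e + e') := by
  simp only [B.comb]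
  module

lemma B.zero_eq_comb : (0 : B k) = B.comb 0 0 0 0 0 := by simp [B.comb]

lemma B.x_eq_comb : B.x k = B.comb 0 1 0 0 0 := by simp [B.comb]

lemma B.y_eq_comb : B.y k = B.comb 0 0 1 0 0 := by simp [B.comb]

lemma w_eq_comb (q : kˣ) : w k q = B.comb 0 0 0 1 (-(q : k)) := by
  simp [B.comb, w, sub_eq_add_neg]

lemma B.exists_comb (b : B k) : ∃ α β γ δ ε, b = B.comb α β γ δ ε := by
  obtain ⟨p, rfl⟩ := mkB_surjective k b
  induction p using FreeAlgebra.induction with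
  | grade0 r => exact ⟨r, 0, 0, 0, 0, by rw [AlgHom.commutes]; simp [B.comb, Algebra.smul_def]⟩
  | grade1 i =>
    fin_cases i
    · exact ⟨_, _, _, _, _, B.x_eq_comb⟩
    · exact ⟨_, _, _, _, _, B.y_eq_comb⟩
  | mul a b ha hb =>
    obtain ⟨_, _, _, _, _, ha⟩ := ha
    obtain ⟨_, _, _, _, _, hb⟩ := hb
    exact ⟨_, _, _, _, _, by rw [map_mul, ha, hb, B.comb_mul]⟩
  | add a b ha hb =>
    obtain ⟨a1, a2, a3, a4, a5, ha⟩ := ha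
    obtain ⟨b1, b2, b3, b4, b5, hb⟩ := hb
    refine ⟨a1 + b1, a2 + b2, a3 + b3, a4 + b4, a5 + b5, ?_⟩
    rw [map_add, ha, hb, B.comb_add]

/-- The spanning set `1, x, y, xy, yx` is linearly independent. The strictly upper triangular
`3 × 3` matrices `x ↦ E₀₁, y ↦ E₁₂` detect all coefficients but that of `yx`, and exchanging
`x` and `y` detects the last one. -/
lemma B.comb_injective {α β γ δ ε α' β' γ' δ' ε' : k}
    (h : B.comb α β γ δ ε = B.comb α' β' γ' δ' ε') :
    α = α' ∧ β = β' ∧ γ = γ' ∧ δ = δ' ∧ ε = ε' := by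
  let U : Matrix (Fin 3) (Fin 3) k := !![0, 1, 0; 0, 0, 0; 0, 0, 0]
  let V : Matrix (Fin 3) (Fin 3) k := !![0, 0, 0; 0, 0, 1; 0, 0, 0]
  have hUU : U * U = 0 := by
    ext i j; fin_cases i <;> fin_cases j <;> simp [U]
  have hVV : V * V = 0 := by
    ext i j; fin_cases i <;> fin_cases j <;> simp [V]
  have hUVU : U * V * U = 0 := by
    ext i j; fin_cases i <;> fin_cases j <;> simp [U, V]
  have hVUV : V * U * V = 0 := by
    ext i j; fin_cases i <;> fin_cases j <;> simp [U, V]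
  have h1 := congrArg (B.lift k U V hUU hVV hUVU hVUV) h
  have h2 := congrArg (B.lift k V U hVV hUU hVUV hUVU) h
  simp only [B.comb, map_add, map_smul, map_mul, map_one, B.lift_x, B.lift_y] at h1 h2
  have e1 := congrFun (congrFun h1 0) 0
  have e2 := congrFun (congrFun h1 0) 1
  have e3 := congrFun (congrFun h1 1) 2
  have e4 := congrFun (congrFun h1 0) 2
  have e5 := congrFun (congrFun h2 0) 2
  simp [U, V] at e1 e2 e3 e4 e5
  exact ⟨e1, e2, e3, e4, e5⟩

end Basis

/-! ### Divisibility in free `B`-modules -/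

/-- The divisibility properties, for the action on `M` of ring elements `w`, `a`, `b`, that the
diagram chase `exact_of_factorization` rests on. They hold for free `B`-modules with
`{a, b} = {x, y}`. -/
structure Divisibility {R : Type*} [Ring R] (w a b : R) (M : Type*) [AddCommGroup M]
    [Module R M] : Prop where
  inter_left : ∀ u v : M, a • u = w • v → a • u = 0
  inter_right : ∀ u v : M, b • u = w • v → b • u = 0
  inter : ∀ u v : M, b • u = a • v → b • u = 0
  ann_left : ∀ u : M, a • u = 0 → ∃ s t : M, u = a • s + w • t
  ann_right : ∀ u : M, b • u = 0 → ∃ s t : M, u = b • s + w • t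
  ann : ∀ u : M, w • u = 0 → ∃ s t : M, u = a • s + b • t

namespace Divisibility

variable {R : Type*} [Ring R] {w a b : R}

lemma pi {ι : Type*} (h : Divisibility w a b R) : Divisibility w a b (ι → R) where
  inter_left u v e := funext fun i => h.inter_left (u i) (v i) (congrFun e i)
  inter_right u v e := funext fun i => h.inter_right (u i) (v i) (congrFun e i)
  inter u v e := funext fun i => h.inter (u i) (v i) (congrFun e i)
  ann_left u e := by
    choose s t hst using fun i => h.ann_left (u i) (congrFun e i)
    exact ⟨s, t, funext hst⟩
  ann_right u e := by
    choose s t hst using fun i => h.ann_right (u i) (congrFun e i)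
    exact ⟨s, t, funext hst⟩
  ann u e := by
    choose s t hst using fun i => h.ann (u i) (congrFun e i)
    exact ⟨s, t, funext hst⟩

lemma of_equiv {M N : Type*} [AddCommGroup M] [Module R M] [AddCommGroup N] [Module R N]
    (φ : M ≃ₗ[R] N) (h : Divisibility w a b N) : Divisibility w a b M where
  inter_left u v e := by
    have := h.inter_left (φ u) (φ v) (by rw [← map_smul, e, map_smul])
    rwa [← map_smul, LinearEquiv.map_eq_zero_iff] at this
  inter_right u v e := by
    have := h.inter_right (φ u) (φ v) (by rw [← map_smul, e, map_smul])
    rwa [← map_smul, LinearEquiv.map_eq_zero_iff] at this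
  inter u v e := by
    have := h.inter (φ u) (φ v) (by rw [← map_smul, e, map_smul])
    rwa [← map_smul, LinearEquiv.map_eq_zero_iff] at this
  ann_left u e := by
    obtain ⟨s, t, hst⟩ := h.ann_left (φ u) (by rw [← map_smul, e, map_zero])
    exact ⟨φ.symm s, φ.symm t, φ.injective (by simp [hst])⟩
  ann_right u e := by
    obtain ⟨s, t, hst⟩ := h.ann_right (φ u) (by rw [← map_smul, e, map_zero])
    exact ⟨φ.symm s, φ.symm t, φ.injective (by simp [hst])⟩
  ann u e := by
    obtain ⟨s, t, hst⟩ := h.ann (φ u) (by rw [← map_smul, e, map_zero])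
    exact ⟨φ.symm s, φ.symm t, φ.injective (by simp [hst])⟩

lemma of_free (h : Divisibility w a b R) (M : Type*) [AddCommGroup M]
    [Module R M] [Module.Free R M] [Module.Finite R M] : Divisibility w a b M :=
  h.pi.of_equiv (Module.Free.chooseBasis R M).equivFun

end Divisibility

section DivisibilityB

variable (k : Type u) [Field k] (q : kˣ)

lemma divisibility_x_y : Divisibility (w k q) (B.x k) (B.y k) (B k) where
  inter_left u v e := by
    obtain ⟨a1, a2, a3, a4, a5, rfl⟩ := B.exists_comb u
    obtain ⟨b1, b2, b3, b4, b5, rfl⟩ := B.exists_comb v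
    simp only [smul_eq_mul, w_eq_comb, B.x_eq_comb, B.comb_mul, B.zero_eq_comb] at e ⊢
    obtain ⟨h1, h2, h3, h4, h5⟩ := B.comb_injective e
    have hq := q.ne_zero
    simp only [zero_mul, one_mul, add_zero, zero_add] at h1 h2 h3 h4 h5 ⊢
    simp_all
  inter_right u v e := by
    obtain ⟨a1, a2, a3, a4, a5, rfl⟩ := B.exists_comb u
    obtain ⟨b1, b2, b3, b4, b5, rfl⟩ := B.exists_comb v
    simp only [smul_eq_mul, w_eq_comb, B.y_eq_comb, B.comb_mul, B.zero_eq_comb] at e ⊢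
    obtain ⟨h1, h2, h3, h4, h5⟩ := B.comb_injective e
    simp only [zero_mul, one_mul, add_zero, zero_add] at h1 h2 h3 h4 h5 ⊢
    rw [h3, h5, ← h4, mul_zero]
  inter u v e := by
    obtain ⟨a1, a2, a3, a4, a5, rfl⟩ := B.exists_comb u
    obtain ⟨b1, b2, b3, b4, b5, rfl⟩ := B.exists_comb v
    simp only [smul_eq_mul, B.x_eq_comb, B.y_eq_comb, B.comb_mul, B.zero_eq_comb] at e ⊢
    obtain ⟨h1, h2, h3, h4, h5⟩ := B.comb_injective e
    simp only [zero_mul, one_mul, add_zero, zero_add] at h1 h2 h3 h4 h5 ⊢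
    rw [h3, h5]
  ann_left u e := by
    obtain ⟨a1, a2, a3, a4, a5, rfl⟩ := B.exists_comb u
    rw [smul_eq_mul, B.x_eq_comb, B.comb_mul, B.zero_eq_comb] at e
    obtain ⟨-, h1, -, h3, -⟩ := B.comb_injective e
    -- `yx = q⁻¹ (xy - w)`
    refine ⟨B.comb a2 0 (a4 + a5 * (q : k)⁻¹) 0 0, B.comb (-a5 * (q : k)⁻¹) 0 0 0 0, ?_⟩
    simp only [smul_eq_mul, w_eq_comb, B.x_eq_comb, B.comb_mul, B.comb_add]
    simp only [zero_mul, one_mul, mul_zero, add_zero, zero_add] at h1 h3 ⊢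
    congr 1 <;> field_simp
    simp [*]
  ann_right u e := by
    obtain ⟨a1, a2, a3, a4, a5, rfl⟩ := B.exists_comb u
    rw [smul_eq_mul, B.y_eq_comb, B.comb_mul, B.zero_eq_comb] at e
    obtain ⟨-, -, h1, -, h2⟩ := B.comb_injective e
    -- `xy = w + q yx`
    refine ⟨B.comb a3 (a5 + a4 * q) 0 0 0, B.comb a4 0 0 0 0, ?_⟩
    simp only [smul_eq_mul, w_eq_comb, B.y_eq_comb, B.comb_mul, B.comb_add]
    simp only [zero_mul, one_mul, mul_zero, add_zero, zero_add] at h1 h2 ⊢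
    congr 1
    ring
  ann u e := by
    obtain ⟨a1, a2, a3, a4, a5, rfl⟩ := B.exists_comb u
    rw [smul_eq_mul, w_eq_comb, B.comb_mul, B.zero_eq_comb] at e
    obtain ⟨-, -, -, h1, -⟩ := B.comb_injective e
    refine ⟨B.comb a2 0 a4 0 0, B.comb a3 a5 0 0 0, ?_⟩
    simp only [smul_eq_mul, B.x_eq_comb, B.y_eq_comb, B.comb_mul, B.comb_add]
    simp only [zero_mul, one_mul, mul_zero, add_zero, zero_add] at h1 ⊢
    rw [h1]

lemma divisibility_y_x : Divisibility (w k q) (B.y k) (B.x k) (B k) where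
  inter_left := (divisibility_x_y k q).inter_right
  inter_right := (divisibility_x_y k q).inter_left
  inter u v e := by
    rw [e]
    exact (divisibility_x_y k q).inter v u e.symm
  ann_left := (divisibility_x_y k q).ann_right
  ann_right := (divisibility_x_y k q).ann_left
  ann u e := by
    obtain ⟨s, t, h⟩ := (divisibility_x_y k q).ann u e
    exact ⟨t, s, h.trans (add_comm _ _)⟩

end DivisibilityB

/-! ### Images of factorizations have no `x`- or `y`-homology -/

/-- If `f`, `g` form a factorization of `w`, an image `f m` with `a • f m ∈ wG` lies in
`a • f(F) + wG`. The scalars `α`, `β` are those by which the twist `ν` acts on `a` and `b`. -/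
lemma exact_of_factorization {R F G : Type*} [Ring R] [AddCommGroup F] [AddCommGroup G]
    [Module R F] [Module R G] {ν : R →+* R} {w a b : R} (hF : Divisibility w a b F)
    (hG : Divisibility w a b G) (haa : a * a = 0) (haba : a * b * a = 0)
    (hbb : b * b = 0) {α β : Rˣ} (hα : ν a = α * a) (hαa : Commute (α : R) a) (hβ : ν b = β * b)
    (hβb : Commute (β : R) b) (f : F →ₗ[R] G) (g : G →ₛₗ[ν] F) (hgf : ∀ m, g (f m) = w • m)
    (hfg : ∀ n, f (g n) = w • n) (m : F) (n : G) (hm : a • f m = w • n) :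
    ∃ (m' : F) (n' : G), f m = a • f m' + w • n' := by
  have hga (u : G) : g (a • u) = a • (α : R) • g u := by
    rw [LinearMap.map_smulₛₗ, hα, hαa.eq, mul_smul]
  have hgb (u : G) : g (b • u) = b • (β : R) • g u := by
    rw [LinearMap.map_smulₛₗ, hβ, hβb.eq, mul_smul]
  have cancel {c : R} {γ : Rˣ} (hc : Commute (γ : R) c) {z : F} (hz : c • (γ : R) • z = 0) :
      c • z = 0 := by
    rw [smul_smul, ← hc.eq, mul_smul] at hz
    have := congrArg (fun z => ((γ⁻¹ : Rˣ) : R) • z) hz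
    simpa [smul_smul, ← mul_assoc] using this
  -- Each round has the same shape: apply `g` or `f` to an equation to equate multiples of two
  -- different elements among `a`, `b`, `w`; both sides then vanish, and the description of the
  -- annihilators yields the next equation.
  obtain ⟨s, t, hst⟩ := hG.ann_left _ (hG.inter_left _ _ hm)
  have h1 : f (m - g t) = a • s := by rw [map_sub, hfg, hst, add_sub_cancel_right]
  have h2 : a • (α : R) • g s = w • (m - g t) := by rw [← hga, ← h1, hgf]
  obtain ⟨e, e', he⟩ := hF.ann_left _ (cancel hαa (hF.inter_left _ _ h2))
  have h3 : g (s - f e') = a • e := by rw [map_sub, hgf, he, add_sub_cancel_right]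
  have h4 : a • f e = w • (s - f e') := by rw [← map_smul, ← h3, hfg]
  obtain ⟨h, h', hh⟩ := hG.ann _ (h4.symm.trans (hG.inter_left _ _ h4))
  have h5 : b • (β : R) • g h' = a • (e - (α : R) • g h) := by
    rw [← hgb, smul_sub, ← hga, ← h3, hh, map_add, add_sub_cancel_left]
  obtain ⟨p, r, hpr⟩ := hF.ann_right _ (cancel hβb (hF.inter _ _ h5))
  have h6 : b • f p = w • (h' - f r) := by
    rw [smul_sub, ← hfg, hpr, map_add, map_smul, map_smul, add_sub_cancel_right]
  obtain ⟨c, d, hcd⟩ := hG.ann _ (h6.symm.trans (hG.inter_right _ _ h6))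
  -- `s = f (e' + b • r) + a • h + b • a • c + b • b • d`, and `a` kills the last three terms
  refine ⟨e' + b • r, t, ?_⟩
  rw [hst, sub_eq_iff_eq_add.mp hh, sub_eq_iff_eq_add.mp hcd]
  have habb : a * (b * b) = 0 := by rw [hbb, mul_zero]
  have haba' : a * (b * a) = 0 := by rw [← mul_assoc, haba]
  simp only [smul_add, smul_smul, map_add, map_smul, haa, habb, haba', zero_smul]
  abel

section Exact

variable {k : Type u} [Field k] {q : kˣ}

/-- The kernel of the action of `a ∈ A` on `M` is contained in its image. For `a * a = 0` this is
the vanishing of the homology of `M` with differential `a`. -/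
def ExactAt (a : A k q) (M : Type*) [AddCommGroup M] [Module (A k q) M] : Prop :=
  ∀ m : M, a • m = 0 → ∃ m', m = a • m'

variable (k q)

lemma proj_x : proj k q (B.x k) = A.x k q := B.lift_x k _ _ _ _ _ _

lemma proj_y : proj k q (B.y k) = A.y k q := B.lift_y k _ _ _ _ _ _

lemma proj_surjective : Function.Surjective (proj k q) := fun a => by
  obtain ⟨p, rfl⟩ := mkA_surjective k q a
  exact ⟨_, proj_mkB k q p⟩

variable {k q}

lemma proj_smul_red {M : Type u} [AddCommGroup M] [Module (B k) M] (b : B k) (m : Red k q M) :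
    proj k q b • m = b • m := by
  obtain ⟨p, rfl⟩ := mkB_surjective k b
  rw [proj_mkB, mkA_smul_red]

lemma proj_smul_redMk {M : Type u} [AddCommGroup M] [Module (B k) M] (b : B k) (m : M) :
    proj k q b • redMk k q M m = redMk k q M (b • m) := by
  rw [proj_smul_red, map_smul]

lemma exactAt_im {a : B k} (X : Factorization k q)
    (h : ∀ m n, a • X.f m = w k q • n → ∃ m' n', X.f m = a • X.f m' + w k q • n') :
    ExactAt (proj k q a) X.im := by
  rintro ⟨_, ⟨z, rfl⟩⟩ hz
  obtain ⟨m, rfl⟩ := redMk_surjective k q X.F z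
  have hz' : proj k q a • redMk k q X.G (X.f m) = 0 := congrArg Subtype.val hz
  rw [proj_smul_redMk, redMk_eq_zero_iff] at hz'
  obtain ⟨n, hn⟩ := hz'
  obtain ⟨m', n', h'⟩ := h m n hn
  refine ⟨⟨redMap k q X.f (redMk k q X.F m'), LinearMap.mem_range_self _ _⟩, Subtype.ext ?_⟩
  change redMk k q X.G (X.f m) = proj k q a • redMk k q X.G (X.f m')
  rw [proj_smul_redMk, h', map_add, add_eq_left, redMk_eq_zero_iff]
  exact ⟨n', rfl⟩

lemma exactAt_im_x (X : Factorization k q) : ExactAt (A.x k q) X.im := by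
  rw [← proj_x]
  have hα : IsUnit (algebraMap k (B k) (-(q : k)⁻¹)) :=
    (IsUnit.mk0 _ (neg_ne_zero.mpr (inv_ne_zero q.ne_zero))).map _
  have hβ : IsUnit (algebraMap k (B k) (-(q : k))) :=
    (IsUnit.mk0 _ (neg_ne_zero.mpr q.ne_zero)).map _
  refine exactAt_im X fun m n hm => exact_of_factorization
    ((divisibility_x_y k q).of_free _) ((divisibility_x_y k q).of_free _) (B.xx k) (B.xyx k)
    (B.yy k) (α := hα.unit) (β := hβ.unit) (ν := nu k q) ?_ ?_ ?_ ?_ X.f X.g X.g_f X.f_g m n hm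
  · exact (nuAlg_x k q).trans (Algebra.smul_def _ _)
  · exact Algebra.commutes _ _
  · exact (nuAlg_y k q).trans (Algebra.smul_def _ _)
  · exact Algebra.commutes _ _

lemma exactAt_im_y (X : Factorization k q) : ExactAt (A.y k q) X.im := by
  rw [← proj_y]
  have hα : IsUnit (algebraMap k (B k) (-(q : k)⁻¹)) :=
    (IsUnit.mk0 _ (neg_ne_zero.mpr (inv_ne_zero q.ne_zero))).map _
  have hβ : IsUnit (algebraMap k (B k) (-(q : k))) :=
    (IsUnit.mk0 _ (neg_ne_zero.mpr q.ne_zero)).map _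
  refine exactAt_im X fun m n hm => exact_of_factorization
    ((divisibility_y_x k q).of_free _) ((divisibility_y_x k q).of_free _) (B.yy k) (B.yxy k)
    (B.xx k) (α := hβ.unit) (β := hα.unit) (ν := nu k q) ?_ ?_ ?_ ?_ X.f X.g X.g_f X.f_g m n hm
  · exact (nuAlg_y k q).trans (Algebra.smul_def _ _)
  · exact Algebra.commutes _ _
  · exact (nuAlg_x k q).trans (Algebra.smul_def _ _)
  · exact Algebra.commutes _ _

/-! ### Invariance under stable isomorphism -/

/-- The regular module has no homology at the class of `a`: acting on the class of `1` in `B/wB`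
lifts an equation `ac = 0` in `A` to `ac ∈ wB`. -/
lemma exactAt_self {a b : B k} (h : Divisibility (w k q) a b (B k)) :
    ExactAt (proj k q a) (A k q) := by
  intro c hc
  obtain ⟨c, rfl⟩ := proj_surjective k q c
  have h1 : redMk k q (B k) (a * c) = 0 := by
    rw [← mul_one (a * c), ← smul_eq_mul (a * c), ← proj_smul_redMk, map_mul, ← smul_eq_mul, hc,
      zero_smul]
  obtain ⟨d, hd⟩ := (redMk_eq_zero_iff k q (B k) _).mp h1
  obtain ⟨s, t, rfl⟩ := h.ann_left c (h.inter_left c d hd)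
  refine ⟨proj k q s, ?_⟩
  simp only [smul_eq_mul, map_add, map_mul, proj_w, zero_mul, add_zero]

lemma ExactAt.of_projective {a : A k q} (h : ExactAt a (A k q)) (P : Type*) [AddCommGroup P]
    [Module (A k q) P] [Module.Finite (A k q) P] [Module.Projective (A k q) P] :
    ExactAt a P := by
  intro p hp
  obtain ⟨n, s, hs⟩ := Module.Finite.exists_fin' (A k q) P
  obtain ⟨i, hi⟩ := Module.projective_lifting_property s LinearMap.id hs
  have hip : a • i p = 0 := by rw [← map_smul, hp, map_zero]
  choose z hz using fun j => h (i p j) (congrFun hip j)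
  refine ⟨s z, ?_⟩
  rw [← map_smul, show a • z = i p from (funext hz).symm]
  exact (DFunLike.congr_fun hi p).symm

/-- Vanishing of the homology at `a` passes to stable direct summands, since it vanishes on
projective modules. -/
lemma ExactAt.of_stable_iso {a : A k q} (h : ExactAt a (A k q)) {M N : FGModuleCat.{u} (A k q)}
    (hM : ExactAt a M) (e : (toStable k q).obj M ≅ (toStable k q).obj N) : ExactAt a N := by
  obtain ⟨α, hα⟩ := (toStable k q).map_surjective e.hom
  obtain ⟨β, hβ⟩ := (toStable k q).map_surjective e.inv
  have h1 : (toStable k q).map (𝟙 N) = (toStable k q).map (β ≫ α) := by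
    rw [Functor.map_comp, hα, hβ, e.inv_hom_id]
    rfl
  obtain ⟨P, hP, γ, δ, hγδ⟩ := (CategoryTheory.Quotient.functor_map_eq_iff _ _ _).mp h1
  intro c hc
  have hdec : c = α.hom.hom (β.hom.hom c) + δ.hom.hom (γ.hom.hom c) := by
    have := congrArg (fun (φ : N ⟶ N) => φ.hom.hom c) hγδ
    exact sub_eq_iff_eq_add'.mp this
  obtain ⟨m, hm⟩ := hM (β.hom.hom c) (by rw [← map_smul, hc, map_zero])
  obtain ⟨p, hp⟩ := h.of_projective P (γ.hom.hom c) (by rw [← map_smul, hc, map_zero])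
  refine ⟨α.hom.hom m + δ.hom.hom p, ?_⟩
  rw [smul_add, ← map_smul, ← map_smul, ← hm, ← hp]
  exact hdec

lemma exactAt_of_mem_essImage {a b : B k} (h : Divisibility (w k q) a b (B k))
    (him : ∀ X : Factorization k q, ExactAt (proj k q a) X.im) {N : FGModuleCat.{u} (A k q)}
    (hN : (T k q).essImage ((toStable k q).obj N)) : ExactAt (proj k q a) N := by
  obtain ⟨Y, ⟨e⟩⟩ := hN
  exact (exactAt_self h).of_stable_iso (him Y.as) e

/-! ### Ranks and dimensions over `k` -/

lemma finrank_range_of_ker_le_range {V : Type*} [AddCommGroup V] [Module k V] (φ : V →ₗ[k] V)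
    (h2 : ∀ v, φ (φ v) = 0) (h : ∀ v, φ v = 0 → ∃ v', v = φ v') {n : ℕ} (hn : 1 ≤ n)
    (hdim : Module.finrank k V = 2 * n) : Module.finrank k (LinearMap.range φ) = n := by
  have hfin : Module.Finite k V := Module.finite_of_finrank_pos (by omega)
  have hker : LinearMap.ker φ = LinearMap.range φ := by
    ext m
    constructor
    · intro hm
      obtain ⟨m', hm'⟩ := h m hm
      exact ⟨m', hm'.symm⟩
    · rintro ⟨m', rfl⟩
      exact h2 m'
  have := LinearMap.finrank_range_add_finrank_ker φ
  rw [hker] at this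
  omega

/-- If `a * a = 0` and the homology at `a` vanishes, the rank of `a` is half the dimension. -/
lemma actionRank_of_exactAt {a : A k q} (haa : a * a = 0) {M : FGModuleCat.{u} (A k q)}
    (h : ExactAt a M) {n : ℕ} (hn : 1 ≤ n) (hdim : dim M = 2 * n) : actionRank M a = n :=
  @finrank_range_of_ker_le_range k _ (RestrictScalars k (A k q) M) _
    (RestrictScalars.module k (A k q) M) (RestrictScalars.lsmul k (A k q) M a)
    (fun m => by
      change a • a • (show M from m) = 0
      rw [smul_smul, haa, zero_smul])
    (fun m hm => by
      obtain ⟨m', hm'⟩ := h m hm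
      exact ⟨m', hm'⟩) _ hn hdim

end Exact

section Jordan

variable {k : Type u} [Field k] {q : kˣ}

/-- The `k`-structure of `C_n(l)` as an `A`-module is that of the space of row vectors. -/
def restrictScalarsC (n : ℕ) (l : OnePoint k) :
    RestrictScalars k (A k q) (C k q n l) ≃ₗ[k] (Fin n ⊕ Fin n → k) where
  toFun v := v
  invFun v := v
  map_add' _ _ := rfl
  map_smul' r v := algebraMap_smul (A k q) r (show CSpace k q n l from v)
  left_inv _ := rfl
  right_inv _ := rfl

lemma dim_C (n : ℕ) (l : OnePoint k) : dim (C k q n l) = 2 * n := by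
  refine (restrictScalarsC n l).finrank_eq.trans ?_
  simp [two_mul]

lemma vecMul_jordan_zero (m : ℕ) (v : Fin (m + 1) → k) :
    Matrix.vecMul v (jordan k (m + 1) 0) = Fin.cons 0 fun j : Fin m => v j.castSucc := by
  ext j
  refine Fin.cases ?_ (fun j => ?_) j
  · simp [Matrix.vecMul, dotProduct, jordan]
  · simp only [Matrix.vecMul, dotProduct, jordan, Matrix.of_apply, Fin.cons_succ]
    rw [Finset.sum_eq_single j.castSucc]
    · simp [Fin.ext_iff]
    · intro i _ hi
      have : (i : ℕ) ≠ j := fun h => hi (Fin.ext h)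
      simp [this]
    · simp

lemma finrank_range_jordan_zero (m : ℕ) :
    Module.finrank k (LinearMap.range (Matrix.fromBlocks 0 (jordan k (m + 1) 0) 0 0 :
      Matrix (Fin (m + 1) ⊕ Fin (m + 1)) (Fin (m + 1) ⊕ Fin (m + 1)) k).vecMulLinear) = m := by
  -- the range consists of the vectors `(0, u)` where `u` has first coordinate zero
  let ι : (Fin m → k) →ₗ[k] (Fin (m + 1) ⊕ Fin (m + 1) → k) :=
    { toFun := fun u => Sum.elim 0 (Fin.cons 0 u)
      map_add' := fun u v => by
        ext (i | i)
        · simp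
        · refine Fin.cases ?_ (fun i => ?_) i <;> simp
      map_smul' := fun r u => by
        ext (i | i)
        · simp
        · refine Fin.cases ?_ (fun i => ?_) i <;> simp }
  have hι : Function.Injective ι := fun u v h => by
    ext i
    exact congrFun h (Sum.inr i.succ)
  have hv (v : Fin (m + 1) ⊕ Fin (m + 1) → k) :
      Matrix.vecMul v (Matrix.fromBlocks 0 (jordan k (m + 1) 0) 0 0) =
        ι fun j => v (Sum.inl j.castSucc) := by
    rw [Matrix.vecMul_fromBlocks]
    simp only [Matrix.vecMul_zero, add_zero, vecMul_jordan_zero]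
    rfl
  have hr : LinearMap.range (Matrix.fromBlocks 0 (jordan k (m + 1) 0) 0 0 :
      Matrix (Fin (m + 1) ⊕ Fin (m + 1)) (Fin (m + 1) ⊕ Fin (m + 1)) k).vecMulLinear =
      LinearMap.range ι := by
    ext v
    constructor
    · rintro ⟨u, rfl⟩
      exact ⟨_, (hv u).symm⟩
    · rintro ⟨u, rfl⟩
      refine ⟨Sum.elim (Fin.snoc u 0) 0, ?_⟩
      refine (hv _).trans (congrArg ι ?_)
      ext j
      simp
  rw [hr, LinearMap.finrank_range_of_inj hι, Module.finrank_fin_fun]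

lemma actionRank_C {n : ℕ} (hn : 1 ≤ n) {l : OnePoint k} {a : A k q}
    (ha : ∀ v : CSpace k q n l,
      a • v = Matrix.vecMul v (Matrix.fromBlocks 0 (jordan k n 0) 0 0)) :
    actionRank (C k q n l) a = n - 1 := by
  obtain ⟨m, rfl⟩ : ∃ m, n = m + 1 := ⟨n - 1, by omega⟩
  have hr : (LinearMap.range (RestrictScalars.lsmul k (A k q) (C k q (m + 1) l) a)).map
      (restrictScalarsC (m + 1) l).toLinearMap =
      LinearMap.range (Matrix.fromBlocks 0 (jordan k (m + 1) 0) 0 0 :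
        Matrix (Fin (m + 1) ⊕ Fin (m + 1)) (Fin (m + 1) ⊕ Fin (m + 1)) k).vecMulLinear := by
    ext v
    constructor
    · rintro ⟨_, ⟨u, rfl⟩, rfl⟩
      exact ⟨u, (ha u).symm⟩
    · rintro ⟨u, rfl⟩
      exact ⟨_, ⟨u, rfl⟩, ha u⟩
  rw [actionRank, ← (restrictScalarsC (m + 1) l).finrank_map_eq]
  exact (congrArg (fun S : Submodule k (Fin (m + 1) ⊕ Fin (m + 1) → k) =>
    Module.finrank k S) hr).trans (finrank_range_jordan_zero m)

end Jordan

/-! ### The factorization with image `C_n(c)`, for `c ≠ 0` -/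

section Tensor

variable {k : Type u} [Field k] {n : ℕ}

/-- The matrix `P ⊗ b` over `B` with entries `Pᵢⱼ b`. -/
def matTensor (P : Matrix (Fin n) (Fin n) k) (b : B k) : Matrix (Fin n) (Fin n) (B k) :=
  Matrix.of fun i j => P i j • b

/-- The row vector `v ⊗ b` over `B` with entries `vᵢ b`. -/
def vecTensor (v : Fin n → k) (b : B k) : Fin n → B k := fun i => v i • b

lemma matTensor_mul (P Q : Matrix (Fin n) (Fin n) k) (b c : B k) :
    matTensor P b * matTensor Q c = matTensor (P * Q) (b * c) := by
  ext i j
  simp [matTensor, Matrix.mul_apply, Finset.sum_smul, smul_smul, mul_comm (Q _ _)]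

lemma vecMul_vecTensor (v : Fin n → k) (P : Matrix (Fin n) (Fin n) k) (b c : B k) :
    Matrix.vecMul (vecTensor v b) (matTensor P c) = vecTensor (Matrix.vecMul v P) (b * c) := by
  ext j
  simp [matTensor, vecTensor, Matrix.vecMul, dotProduct, Finset.sum_smul, smul_smul,
    mul_comm (P _ _)]

lemma vecMul_matTensor_one (u : Fin n → B k) (b : B k) :
    Matrix.vecMul u (matTensor 1 b) = fun i => u i * b := by
  ext j
  simp [matTensor, Matrix.vecMul, dotProduct, Matrix.one_apply, ite_smul]

lemma matTensor_add (P : Matrix (Fin n) (Fin n) k) (b c : B k) :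
    matTensor P b + matTensor P c = matTensor P (b + c) := by
  ext i j
  simp [matTensor]

lemma matTensor_zero (P : Matrix (Fin n) (Fin n) k) : matTensor P 0 = 0 := by
  ext i j
  simp [matTensor]

lemma smul_vecTensor (v : Fin n → k) (b c : B k) :
    c • vecTensor v b = vecTensor v (c * b) := by
  ext i
  simp [vecTensor]

lemma vecTensor_zero (v : Fin n → k) : vecTensor v (0 : B k) = 0 := by
  ext i
  simp [vecTensor]

end Tensor

section Jordan

variable (k : Type u) [Field k] (q : kˣ) (n : ℕ) (c : k)

lemma matrixF_eq : matrixF k q n c =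
    matTensor 1 (B.x k) + matTensor (jordan k n c) ((q : k)⁻¹ • B.y k) := by
  ext i j
  simp [matrixF, matTensor, Matrix.one_apply, smul_smul, mul_comm]

lemma det_jordan : (jordan k n c).det = c ^ n := by
  rw [Matrix.det_of_isUpperTriangular]
  · simp [jordan]
  · intro i j hij
    have h1 : i ≠ j := fun h => by simp [h] at hij
    have h2 : (i : ℕ) + 1 ≠ j := fun h => by
      have : (j : ℕ) < i := hij
      omega
    simp [jordan, h1, h2]

lemma isUnit_det_jordan (hc : c ≠ 0) : IsUnit (jordan k n c).det := by
  rw [det_jordan]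
  exact (pow_ne_zero n hc).isUnit

variable {k} in
/-- Although `ν` is not the identity, `ν(b) w = w b`, because `ν(b) - b` lies in the radical, which
`w` annihilates. -/
lemma nu_mul_w (b : B k) : nu k q b * w k q = w k q * b := by
  obtain ⟨a1, a2, a3, a4, a5, rfl⟩ := B.exists_comb b
  have h : nu k q (B.comb a1 a2 a3 a4 a5) =
      B.comb a1 (a2 * -(q : k)⁻¹) (a3 * -q) a4 a5 := by
    change nuAlg k q _ = _
    simp only [B.comb, map_add, map_smul, map_mul, map_one, nuAlg_x, nuAlg_y, smul_smul,
      smul_mul_smul_comm]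
    simp
  rw [h, w_eq_comb, B.comb_mul, B.comb_mul]
  congr 1 <;> ring

/-- The matrix `q (x J_n(c)⁻¹ - y)` inverse to `xI + q⁻¹ y J_n(c)` up to the twist and the
factor `w`. -/
def matrixG : Matrix (Fin n) (Fin n) (B k) :=
  matTensor (jordan k n c)⁻¹ ((q : k) • B.x k) + matTensor 1 (-(q : k) • B.y k)

/-- The map `v ↦ ν(v) N` for the matrix `N = matrixG k q n c`. -/
def mapG : (Fin n → B k) →ₛₗ[nu k q] (Fin n → B k) where
  toFun v := Matrix.vecMul (fun i => nu k q (v i)) (matrixG k q n c)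
  map_add' u v := by
    rw [← Matrix.add_vecMul]
    congr 1
    ext i
    simp
  map_smul' b v := by
    rw [← Matrix.smul_vecMul]
    congr 1
    ext i
    simp

lemma matrixG_mul_matrixF (hc : c ≠ 0) :
    matrixG k q n c * matrixF k q n c = matTensor 1 (w k q) := by
  have hJ := Matrix.nonsing_inv_mul _ (isUnit_det_jordan k n c hc)
  simp only [matrixG, matrixF_eq, add_mul, mul_add, matTensor_mul, hJ,
    smul_mul_assoc, mul_smul_comm, B.xx, B.yy, smul_zero, matTensor_zero, mul_one, one_mul,
    zero_add, add_zero, smul_smul]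
  rw [matTensor_add]
  congr 1
  simp [w, sub_eq_neg_add]

lemma map_matrixF_mul_matrixG (hc : c ≠ 0) :
    (matrixF k q n c).map (nu k q) * matrixG k q n c = matTensor 1 (w k q) := by
  have hJ := Matrix.mul_nonsing_inv _ (isUnit_det_jordan k n c hc)
  have hM : (matrixF k q n c).map (nu k q) =
      matTensor 1 (-(q : k)⁻¹ • B.x k) + matTensor (jordan k n c) (-B.y k) := by
    rw [matrixF_eq]
    ext i j
    change nuAlg k q _ = _
    simp [matTensor, nuAlg_x, nuAlg_y]
  simp only [hM, matrixG, add_mul, mul_add, matTensor_mul, hJ, neg_mul,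
    smul_mul_assoc, mul_smul_comm, B.xx, B.yy, smul_zero, neg_zero, matTensor_zero, mul_one,
    one_mul, zero_add, add_zero, smul_smul]
  rw [matTensor_add]
  congr 1
  simp [w, sub_eq_neg_add]

lemma mapG_mapF (hc : c ≠ 0) (m : Fin n → B k) : mapG k q n c (mapF k q n c m) = w k q • m := by
  have h : (fun i => nu k q (mapF k q n c m i)) =
      Matrix.vecMul (fun i => nu k q (m i)) ((matrixF k q n c).map (nu k q)) :=
    funext fun i => RingHom.map_vecMul (nu k q) (matrixF k q n c) m i
  change Matrix.vecMul (fun i => nu k q (mapF k q n c m i)) (matrixG k q n c) = _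
  rw [h, Matrix.vecMul_vecMul, map_matrixF_mul_matrixG k q n c hc, vecMul_matTensor_one]
  exact funext fun i => nu_mul_w q (m i)

lemma mapF_mapG (hc : c ≠ 0) (m : Fin n → B k) : mapF k q n c (mapG k q n c m) = w k q • m := by
  change Matrix.vecMul (Matrix.vecMul (fun i => nu k q (m i)) (matrixG k q n c))
    (matrixF k q n c) = _
  rw [Matrix.vecMul_vecMul, matrixG_mul_matrixF k q n c hc, vecMul_matTensor_one]
  exact funext fun i => nu_mul_w q (m i)

lemma mapF_vecTensor (v : Fin n → k) (b : B k) : mapF k q n c (vecTensor v b) =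
    vecTensor v (b * B.x k) +
      vecTensor (Matrix.vecMul v (jordan k n c)) ((q : k)⁻¹ • (b * B.y k)) := by
  change Matrix.vecMul _ (matrixF k q n c) = _
  rw [matrixF_eq, Matrix.vecMul_add, vecMul_vecTensor, vecMul_vecTensor, Matrix.vecMul_one,
    mul_smul_comm]

variable {k q} in
/-- An additive map commuting with scalars, `x` and `y` is `A`-linear. -/
lemma map_smul_of_generators {M N : Type*} [AddCommGroup M] [Module (A k q) M] [AddCommGroup N]
    [Module (A k q) N] (θ : M →+ N)
    (hs : ∀ (r : k) m, θ (algebraMap k (A k q) r • m) = algebraMap k (A k q) r • θ m)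
    (hx : ∀ m, θ (A.x k q • m) = A.x k q • θ m) (hy : ∀ m, θ (A.y k q • m) = A.y k q • θ m)
    (a : A k q) (m : M) : θ (a • m) = a • θ m := by
  obtain ⟨p, rfl⟩ := mkA_surjective k q a
  induction p using FreeAlgebra.induction generalizing m with
  | grade0 r => simpa using hs r m
  | grade1 i =>
    fin_cases i
    · exact hx m
    · exact hy m
  | mul a b ha hb => rw [map_mul, mul_smul, ha, hb, mul_smul]
  | add a b ha hb => rw [map_add, add_smul, map_add, ha, hb, add_smul]

/-- The element `v₁ + y v₂` of `B^n` attached to the element `(v₁, v₂)` of `C_n(c)`. -/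
def liftC (v : CSpace k q n (c : OnePoint k)) : Fin n → B k :=
  vecTensor (fun i => v (Sum.inl i)) 1 + vecTensor (fun i => v (Sum.inr i)) (B.y k)

lemma liftC_add (u v : CSpace k q n (c : OnePoint k)) :
    liftC k q n c (u + v) = liftC k q n c u + liftC k q n c v := by
  ext i
  change (u (Sum.inl i) + v (Sum.inl i)) • (1 : B k) +
    (u (Sum.inr i) + v (Sum.inr i)) • B.y k = (_ • _ + _ • _) + (_ • _ + _ • _)
  module

lemma liftC_smul (r : k) (v : CSpace k q n (c : OnePoint k)) :
    liftC k q n c (r • v) = algebraMap k (B k) r • liftC k q n c v := by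
  ext i
  change (r * v (Sum.inl i)) • (1 : B k) + (r * v (Sum.inr i)) • B.y k =
    algebraMap k (B k) r * (v (Sum.inl i) • (1 : B k) + v (Sum.inr i) • B.y k)
  rw [← Algebra.smul_def]
  module

variable {k n} in
lemma vecMul_upperRight (u : Fin n ⊕ Fin n → k) (P : Matrix (Fin n) (Fin n) k) :
    Matrix.vecMul u (Matrix.fromBlocks 0 P 0 0) =
      Sum.elim (0 : Fin n → k) (Matrix.vecMul (fun i => u (Sum.inl i)) P) := by
  rw [Matrix.vecMul_fromBlocks]
  simp only [Matrix.vecMul_zero, add_zero]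
  rfl

lemma liftC_x_smul (v : CSpace k q n (c : OnePoint k)) : liftC k q n c (A.x k q • v) =
    vecTensor (Matrix.vecMul (fun i => v (Sum.inl i)) (jordan k n c)) (B.y k) := by
  have h : A.x k q • v = Sum.elim (0 : Fin n → k)
      (Matrix.vecMul (fun i => v (Sum.inl i)) (jordan k n c)) :=
    (CSpace.x_smul k q n _ v).trans (vecMul_upperRight v _)
  refine (congrArg (liftC k q n c) h).trans (funext fun i => ?_)
  simp [liftC, vecTensor]

lemma liftC_y_smul (v : CSpace k q n (c : OnePoint k)) : liftC k q n c (A.y k q • v) =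
    vecTensor (fun i => v (Sum.inl i)) (B.y k) := by
  have h : A.y k q • v = Sum.elim (0 : Fin n → k) (Matrix.vecMul (fun i => v (Sum.inl i)) 1) :=
    (CSpace.y_smul k q n _ v).trans (vecMul_upperRight v _)
  refine (congrArg (liftC k q n c) h).trans (funext fun i => ?_)
  simp [liftC, vecTensor]

lemma mapF_liftC (v : CSpace k q n (c : OnePoint k)) : mapF k q n c (liftC k q n c v) =
    vecTensor (fun i => v (Sum.inl i)) (B.x k) +
      vecTensor (Matrix.vecMul (fun i => v (Sum.inl i)) (jordan k n c)) ((q : k)⁻¹ • B.y k) +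
      vecTensor (fun i => v (Sum.inr i)) (B.y k * B.x k) := by
  rw [liftC, map_add, mapF_vecTensor, mapF_vecTensor, B.yy, smul_zero, vecTensor_zero, add_zero,
    one_mul, one_mul]

/-- The `A`-linear map `C_n(c) → B^n/wB^n`, `(v₁, v₂) ↦ f(v₁ + y v₂)`, where `f` is right
multiplication by `xI + q⁻¹ y J_n(c)`. -/
def fromC : CSpace k q n (c : OnePoint k) →ₗ[A k q] Red k q (Fin n → B k) where
  toFun v := redMk k q _ (mapF k q n c (liftC k q n c v))
  map_add' u v := by rw [liftC_add, map_add, map_add]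
  map_smul' := by
    let θ : CSpace k q n (c : OnePoint k) →+ Red k q (Fin n → B k) :=
      AddMonoidHom.mk' (fun v => redMk k q _ (mapF k q n c (liftC k q n c v)))
        fun u v => by rw [liftC_add, map_add, map_add]
    refine map_smul_of_generators θ (fun r v => ?_) (fun v => ?_) (fun v => ?_)
    · change redMk k q _ (mapF k q n c (liftC k q n c _)) = _ • redMk k q _ (mapF k q n c _)
      rw [algebraMap_smul, liftC_smul, ← (proj k q).commutes r, proj_smul_redMk, map_smul]
    · change redMk k q _ (mapF k q n c (liftC k q n c _)) = _ • redMk k q _ (mapF k q n c _)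
      -- the two sides are `v₁ J ⊗ yx` and `v₁ J ⊗ q⁻¹ xy`, congruent modulo `w`
      rw [← proj_x, proj_smul_redMk, proj_x, liftC_x_smul, mapF_liftC, mapF_vecTensor, eq_comm,
        ← sub_eq_zero, ← map_sub, redMk_eq_zero_iff]
      refine ⟨vecTensor (Matrix.vecMul (fun i => v (Sum.inl i)) (jordan k n c))
        ((q : k)⁻¹ • 1), ?_⟩
      simp only [smul_add, smul_vecTensor, B.xx, B.yy, mul_smul_comm, ← mul_assoc, B.xyx,
        vecTensor_zero, smul_zero, add_zero, zero_add, mul_one]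
      ext i
      simp only [vecTensor, Pi.sub_apply, w, smul_sub, smul_smul]
      simp
    · change redMk k q _ (mapF k q n c (liftC k q n c _)) = _ • redMk k q _ (mapF k q n c _)
      rw [← proj_y, proj_smul_redMk, proj_y, ← map_smul, liftC_y_smul, liftC, smul_add,
        smul_vecTensor, smul_vecTensor, B.yy, vecTensor_zero, add_zero, mul_one]

lemma fromC_injective : Function.Injective (fromC k q n c) := by
  rw [injective_iff_map_eq_zero]
  intro v hv
  obtain ⟨m, hm⟩ := (redMk_eq_zero_iff k q _ _).mp hv
  rw [mapF_liftC] at hm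
  have h (i : Fin n) : v (Sum.inl i) = 0 ∧ v (Sum.inr i) = 0 := by
    have hi : v (Sum.inl i) • B.x k +
        Matrix.vecMul (fun i => v (Sum.inl i)) (jordan k n c) i • ((q : k)⁻¹ • B.y k) +
        v (Sum.inr i) • (B.y k * B.x k) = w k q * m i := congrFun hm i
    obtain ⟨a1, a2, a3, a4, a5, ha⟩ := B.exists_comb (m i)
    have hl : B.comb 0 (v (Sum.inl i))
        (Matrix.vecMul (fun i => v (Sum.inl i)) (jordan k n c) i * (q : k)⁻¹) 0
        (v (Sum.inr i)) = w k q * m i := by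
      rw [← hi, B.comb]
      module
    rw [ha, w_eq_comb, B.comb_mul] at hl
    obtain ⟨-, h1, -, h2, h3⟩ := B.comb_injective hl
    simp only [zero_mul, one_mul, add_zero, zero_add] at h1 h2 h3
    exact ⟨h1, by rw [h3, ← h2, mul_zero]⟩
  refine funext fun i => ?_
  rcases i with i | i
  · exact (h i).1
  · exact (h i).2

lemma range_fromC : LinearMap.range (fromC k q n c) =
    LinearMap.range (redMap k q (mapF k q n c)) := by
  apply le_antisymm
  · rintro _ ⟨v, rfl⟩
    exact ⟨redMk k q _ (liftC k q n c v), rfl⟩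
  · rintro _ ⟨z, rfl⟩
    obtain ⟨m, rfl⟩ := redMk_surjective k q _ z
    rw [redMap_mk, LinearMap.pi_apply_eq_sum_univ (mapF k q n c) m, map_sum]
    refine Submodule.sum_mem _ fun i _ => ?_
    rw [← proj_smul_redMk]
    refine Submodule.smul_mem _ _ ⟨Sum.elim (fun j => if i = j then 1 else 0) 0, ?_⟩
    change redMk k q _ (mapF k q n c _) = _
    congr 2
    ext j
    simp [liftC, vecTensor]

/-- The module `C_n(c)` is the image of the reduction of right multiplication by
`xI + q⁻¹ y J_n(c)`. -/
def equivC : CSpace k q n (c : OnePoint k) ≃ₗ[A k q]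
    LinearMap.range (redMap k q (mapF k q n c)) :=
  (LinearEquiv.ofInjective _ (fromC_injective k q n c)).trans
    (LinearEquiv.ofEq _ _ (range_fromC k q n c))

lemma exists_factorization_C (hc : c ≠ 0) :
    ∃ (g : (Fin n → B k) →ₛₗ[nu k q] (Fin n → B k))
      (hgf : ∀ m, g (mapF k q n c m) = w k q • m) (hfg : ∀ m, mapF k q n c (g m) = w k q • m),
      Nonempty ((Factorization.mk (Fin n → B k) (Fin n → B k) (mapF k q n c) g hgf hfg).im ≅
        C k q n (c : OnePoint k)) :=
  ⟨mapG k q n c, mapG_mapF k q n c hc, mapF_mapG k q n c hc,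
    ⟨((equivC k q n c).symm.toFGModuleCatIso :)⟩⟩

end Jordan

/-! ### The essential image of `T` -/

section EssImage

variable {k : Type u} [Field k] {q : kˣ} {n : ℕ}

lemma mem_essImage_of_iso {X : Factorization k q} {N : FGModuleCat.{u} (A k q)} (e : X.im ≅ N) :
    (T k q).essImage ((toStable k q).obj N) :=
  ⟨(CategoryTheory.Quotient.functor _).obj X, ⟨(toStable k q).mapIso e⟩⟩

lemma not_mem_essImage_zero (hn : 1 ≤ n) :
    ¬ (T k q).essImage ((toStable k q).obj (C k q n ((0 : k) : OnePoint k))) := fun h => by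
  have h1 := exactAt_of_mem_essImage (divisibility_x_y k q)
    (fun X => by rw [proj_x]; exact exactAt_im_x X) h
  rw [proj_x] at h1
  have h2 := actionRank_of_exactAt (A.xx k q) h1 hn (dim_C n _)
  rw [actionRank_C hn fun v => CSpace.x_smul k q n _ v] at h2
  omega

lemma not_mem_essImage_infty (hn : 1 ≤ n) :
    ¬ (T k q).essImage ((toStable k q).obj (C k q n OnePoint.infty)) := fun h => by
  have h1 := exactAt_of_mem_essImage (divisibility_y_x k q)
    (fun X => by rw [proj_y]; exact exactAt_im_y X) h
  rw [proj_y] at h1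
  have h2 := actionRank_of_exactAt (A.yy k q) h1 hn (dim_C n _)
  rw [actionRank_C hn fun v => CSpace.y_smul k q n _ v] at h2
  omega

end EssImage

end QCI

end

theorem theorem4p4 (k : Type*) [Field k] [IsAlgClosed k] (q : kˣ) (n : ℕ) (hn : 1 ≤ n) :
    -- `C_n(l)` lies in the image of `T` iff `l ∉ {0, ∞}`
    (∀ l : OnePoint k,
      (QCI.T k q).essImage ((QCI.toStable k q).obj (QCI.C k q n l)) ↔
        l ∉ ({((0 : k) : OnePoint k), OnePoint.infty} : Set (OnePoint k))) ∧
    -- for `0 ≠ c ∈ k` the map `f = xI + q⁻¹ y J_n(c)` belongs to a factorization giving `C_n(c)`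
    (∀ c : k, c ≠ 0 →
      ∃ (g : (Fin n → QCI.B k) →ₛₗ[QCI.nu k q] (Fin n → QCI.B k))
        (hgf : ∀ m, g (QCI.mapF k q n c m) = QCI.w k q • m)
        (hfg : ∀ m, QCI.mapF k q n c (g m) = QCI.w k q • m),
        Nonempty ((QCI.Factorization.mk (Fin n → QCI.B k) (Fin n → QCI.B k)
          (QCI.mapF k q n c) g hgf hfg).im ≅ QCI.C k q n (c : OnePoint k))) ∧
    -- no factorization gives `C_n(0)` or `C_n(∞)`
    (¬ ∃ X : QCI.Factorization k q, Nonempty (X.im ≅ QCI.C k q n ((0 : k) : OnePoint k))) ∧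
    (¬ ∃ X : QCI.Factorization k q, Nonempty (X.im ≅ QCI.C k q n OnePoint.infty)) ∧
    -- `x` on `C_n(0)` and `y` on `C_n(∞)` have rank `n - 1`, whereas both have rank `n` on every
    -- `2n`-dimensional module coming from a factorization
    QCI.actionRank (QCI.C k q n ((0 : k) : OnePoint k)) (QCI.A.x k q) = n - 1 ∧
    QCI.actionRank (QCI.C k q n OnePoint.infty) (QCI.A.y k q) = n - 1 ∧
    (∀ X : QCI.Factorization k q, QCI.dim X.im = 2 * n →
      QCI.actionRank X.im (QCI.A.x k q) = n ∧ QCI.actionRank X.im (QCI.A.y k q) = n) := by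
  have h0 := QCI.not_mem_essImage_zero (k := k) (q := q) hn
  have hinf := QCI.not_mem_essImage_infty (k := k) (q := q) hn
  refine ⟨fun l => ⟨?_, fun hl => ?_⟩, fun c hc => QCI.exists_factorization_C k q n c hc,
    fun ⟨X, ⟨e⟩⟩ => h0 (QCI.mem_essImage_of_iso e),
    fun ⟨X, ⟨e⟩⟩ => hinf (QCI.mem_essImage_of_iso e),
    QCI.actionRank_C hn fun v => QCI.CSpace.x_smul k q n _ v,
    QCI.actionRank_C hn fun v => QCI.CSpace.y_smul k q n _ v,
    fun X hX => ⟨QCI.actionRank_of_exactAt (QCI.A.xx k q) (QCI.exactAt_im_x X) hn hX,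
      QCI.actionRank_of_exactAt (QCI.A.yy k q) (QCI.exactAt_im_y X) hn hX⟩⟩
  · rintro h (rfl | rfl)
    · exact h0 h
    · exact hinf h
  · induction l using OnePoint.rec with
    | infty => exact absurd (Or.inr rfl) hl
    | coe c =>
      obtain ⟨g, hgf, hfg, ⟨e⟩⟩ := QCI.exists_factorization_C k q n c
        fun hc => hl (Or.inl (congrArg _ hc))
      exact QCI.mem_essImage_of_iso e
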